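/- Let $p$ be an odd prime and let $L/k$ be a cyclic extension of degree $p$, where $k$ and $L$ are CM-fields (totally complex quadratic extensions of totally real number fields). Let $J$ denote complex conjugation on $k$, and let $\mathrm{Cl}^-(k)=\{c\in \mathrm{Cl}(k): c^{1+J}=1\}$. Let $\kappa_{L/k}$ be the capitulation kernel, i.e. the kernel of the homomorphism $\mathrm{Cl}(k)\to \mathrm{Cl}(L)$, $[\mathfrak a]\mapsto[\mathfrak a\mathcal O_L]$, and put $\kappa_{L/k}^-=\kappa_{L/k}\cap \mathrm{Cl}^-(k)$. For $m \ge 1$ let $\zeta_m$ denote a primitive $m$-th root of unity. If $\zeta_p\in k$, call $L/k$ essentially ramified if $L=k(\sqrt[p]{\alpha})$ for some $\alpha\in k$ such that the principal fractional ideal $\alpha\mathcal O_k$ is not the $p$-th power of a fractional ideal of $k$. Then $\kappa_{L/k}^-=1$ if and only if one of the following conditions holds: (i) $\zeta_p\notin k$; (ii) $\zeta_p\in k$ and $L=k(\zeta_{p^n})$ for some $n\ge 2$; (iii) $\zeta_p\in k$ and $L/k$ is essentially ramified. Moreover, if $\#\kappa_{L/k}^-=p$, then there are a nonzero $\beta\in\mathcal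 O_k$ and a nonzero ideal $\mathfrak b$ of $\mathcal O_k$ such that $L=k(\sqrt[p]{\beta})$, $\beta\mathcal O_k=\mathfrak b^p$, and $\kappa_{L/k}^-=\langle[\mathfrak b]\rangle$. -/

import Mathlib

open NumberField
open scoped nonZeroDivisors

noncomputable section

namespace Capitulation

/-- The action of complex conjugation `J` on the ideal class group of a CM-field `k`,
induced by the automorphism `J` of the ring of integers of `k`. -/
def classConj (k : Type*) [Field k] [NumberField k] [IsCMField k] :
    ClassGroup (𝓞 k) ≃* ClassGroup (𝓞 k) :=
  ClassGroup.mulEquiv (IsCMField.ringOfIntegersComplexConj k).toRingEquiv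

/-- The minus class group `Cl⁻(k)` of a CM-field `k`: the ideal classes killed by `1 + J`. -/
def minusClassGroup (k : Type*) [Field k] [NumberField k] [IsCMField k] :
    Subgroup (ClassGroup (𝓞 k)) :=
  (MonoidHom.id (ClassGroup (𝓞 k)) * (classConj k).toMonoidHom).ker

/-- The capitulation kernel `κ_{L/k}`: the ideal classes of `k` that become trivial in `L`, i.e.
the kernel of the homomorphism `Cl(k) → Cl(L)` sending `[𝔞]` to `[𝔞 𝓞_L]`. -/
def kappa (k L : Type*) [Field k] [NumberField k] [Field L] [NumberField L] [Algebra k L] :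
    Subgroup (ClassGroup (𝓞 k)) :=
  (ClassGroup.extendedHom (𝓞 k) (𝓞 L)).ker

/-- The minus part `κ_{L/k}⁻ = κ_{L/k} ∩ Cl⁻(k)` of the capitulation kernel. -/
def kappaMinus (k L : Type*) [Field k] [NumberField k] [IsCMField k]
    [Field L] [NumberField L] [Algebra k L] : Subgroup (ClassGroup (𝓞 k)) :=
  kappa k L ⊓ minusClassGroup k

/-- `L = k(α^{1/p})`: the field `L` is generated over `k` by a `p`-th root of `α`. -/
def IsGeneratedByRoot (p : ℕ) {k : Type*} (L : Type*) [Field k] [Field L] [Algebra k L]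
    (α : k) : Prop :=
  ∃ x : L, x ^ p = algebraMap k L α ∧ IntermediateField.adjoin k {x} = ⊤

/-- `L = k(ζ_m)`: the field `L` is generated over `k` by a primitive `m`-th root of unity. -/
def IsGeneratedByRootOfUnity (m : ℕ) (k L : Type*) [Field k] [Field L] [Algebra k L] : Prop :=
  ∃ ζ : L, IsPrimitiveRoot ζ m ∧ IntermediateField.adjoin k {ζ} = ⊤

/-- For a number field `k` containing `ζ_p`, a cyclic extension `L/k` of degree `p` is essentially
ramified if `L = k(α^{1/p})` for some `α ∈ k` such that the principal (fractional) ideal `α 𝓞_k`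
is not the `p`-th power of a (fractional) ideal. -/
def IsEssentiallyRamified (p : ℕ) (k L : Type*) [Field k] [NumberField k] [Field L]
    [Algebra k L] : Prop :=
  ∃ α : k, IsGeneratedByRoot p L α ∧
    ¬ ∃ 𝔞 : FractionalIdeal (𝓞 k)⁰ k, FractionalIdeal.spanSingleton (𝓞 k)⁰ α = 𝔞 ^ p

end Capitulation

end

namespace Capitulation

/-! ### Eigenvectors of a generator of a cyclic group of prime order. -/

section CyclicDegreeP

variable {p : ℕ} {k L : Type*} [Field k] [Field L] [Algebra k L] {σ : L ≃ₐ[k] L}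

/-! Let `σ` generate the Galois group. If `I` becomes `(y)` in `L`, then `σ y = u y` for a unit `u`.
For a minus class, `y * J y` is a unit times an element of `k`, so up to these factors `y ^ 2` is `y
/ J y`, on which `σ` acts by `u / J u`, a root of unity by Kronecker. After a power prime to `p`
this root has `p`-power order, and as `p` is odd it must be 1 or a primitive `p`-th root of unity
(`exists_generator_of_mem_kappaMinus`, `apply_eq_self_or_eq_mul`). If it is 1, the generator
descends to `k` and the class is trivial. Otherwise there is a Kummer generator `A` of `L` whose
`p`-th power is, up to a `p`-th power in `k`, a generator of a `p`-th power ideal; each of the three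
conditions excludes this or lets a root of unity absorb the eigenvalue (`kappaMinus_eq_bot`).

Conversely, if all three fail, a Kummer generator `x` with `x ^ p = β` and `(β) = 𝔟 ^ p` makes `𝔟`
capitulate to `(x)`, giving a nontrivial class in the minus part
(`exists_kummer_class_mem_kappaMinus`). When the kernel has order `p`, this class generates it. -/

theorem exists_algebraMap_eq_of_generator_fixed [FiniteDimensional k L] [IsGalois k L]
    (hσ : ∀ τ : L ≃ₐ[k] L, τ ∈ Subgroup.zpowers σ) {x : L} (hx : σ x = x) :
    ∃ a : k, algebraMap k L a = x := by
  refine (IsGalois.mem_range_algebraMap_iff_fixed x).2 fun τ ↦ ?_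
  have : σ ∈ MulAction.stabilizer (L ≃ₐ[k] L) x := hx
  exact (Subgroup.zpowers_le.2 this) (hσ τ)

theorem algEquiv_pow_apply_eq_self [FiniteDimensional k L] [IsGalois k L]
    (hdeg : Module.finrank k L = p) (σ : L ≃ₐ[k] L) (x : L) : (σ ^ p) x = x := by
  rw [← hdeg, ← IsGalois.card_aut_eq_finrank, pow_card_eq_one']
  rfl

theorem exists_generator_apply_ne [FiniteDimensional k L] [IsGalois k L] (hp : p.Prime)
    (hdeg : Module.finrank k L = p)
    (hσ : ∀ τ : L ≃ₐ[k] L, τ ∈ Subgroup.zpowers σ) {x : L}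
    (hx : IntermediateField.adjoin k {x} = ⊤) : σ x ≠ x := by
  intro h
  obtain ⟨a, rfl⟩ := exists_algebraMap_eq_of_generator_fixed hσ h
  have h1 : IntermediateField.adjoin k {algebraMap k L a} = ⊥ :=
    IntermediateField.adjoin_simple_eq_bot_iff.2 (IntermediateField.algebraMap_mem _ a)
  have h2 := IntermediateField.finrank_top' (F := k) (E := L)
  rw [← hx, h1, IntermediateField.finrank_bot, hdeg] at h2
  exact hp.one_lt.ne h2

theorem adjoin_eq_top_of_apply_ne [FiniteDimensional k L] (hp : p.Prime)
    (hdeg : Module.finrank k L = p) {x : L} (hx : σ x ≠ x) :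
    IntermediateField.adjoin k {x} = ⊤ := by
  have hd : Module.finrank k (IntermediateField.adjoin k {x}) ∣ p :=
    ⟨_, by rw [← hdeg, Module.finrank_mul_finrank k (IntermediateField.adjoin k {x}) L]⟩
  rcases (Nat.dvd_prime hp).1 hd with h | h
  · have := IntermediateField.finrank_adjoin_simple_eq_one_iff.1 h
    obtain ⟨a, rfl⟩ := IntermediateField.mem_bot.1 this
    simp at hx
  · exact IntermediateField.eq_of_le_of_finrank_eq le_top
      (by rw [h, IntermediateField.finrank_top', hdeg])

theorem isPrimitiveRoot_of_pow_eq_one_of_ne_one {M : Type*} [CommMonoid M] (hp : p.Prime) {ω : M}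
    (h : ω ^ p = 1) (h1 : ω ≠ 1) : IsPrimitiveRoot ω p := by
  have := Fact.mk hp
  exact IsPrimitiveRoot.iff_orderOf.2 (orderOf_eq_prime h h1)

/-- An automorphism of order dividing `p` fixes the `p`-th roots of unity, since
`j ^ p ≡ j` modulo `p`. -/
theorem algEquiv_apply_eq_self_of_pow_eq_one [FiniteDimensional k L] [IsGalois k L] (hp : p.Prime)
    (hdeg : Module.finrank k L = p) (σ : L ≃ₐ[k] L) {ω : L} (hω : ω ^ p = 1) : σ ω = ω := by
  have := Fact.mk hp
  rcases eq_or_ne ω 1 with rfl | h1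
  · simp
  have hprim := isPrimitiveRoot_of_pow_eq_one_of_ne_one hp hω h1
  obtain ⟨j, -, hj⟩ := hprim.eq_pow_of_pow_eq_one (ξ := σ ω) (by rw [← map_pow, hω, map_one])
  have hpow : ∀ n : ℕ, (σ ^ n) ω = ω ^ (j ^ n) := by
    intro n
    induction n with
    | zero => simp
    | succ n ih =>
      rw [pow_succ, AlgEquiv.mul_apply, ← hj, map_pow, ih, ← pow_mul, pow_succ]
  have h2 : ω ^ (j ^ p) = ω ^ j := by
    have h3 : j ^ p ≡ j [MOD p] := by
      rw [← ZMod.natCast_eq_natCast_iff]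
      push_cast
      exact ZMod.pow_card _
    rw [pow_eq_pow_mod _ hω, h3, ← pow_eq_pow_mod _ hω]
  rw [← hj, ← h2, ← hpow, algEquiv_pow_apply_eq_self hdeg]

/-- If `x` is not fixed by `σ` but `x ^ p ^ n` is, some power of `x` is an eigenvector of `σ`
for a primitive `p`-th root of unity. -/
theorem exists_pow_apply_eq_mul (hp : p.Prime) (σ : L ≃ₐ[k] L) {x : L} (hx0 : x ≠ 0)
    (hx : σ x ≠ x) {n : ℕ} (hn : σ (x ^ p ^ n) = x ^ p ^ n) :
    ∃ (r : ℕ) (ω : L), IsPrimitiveRoot ω p ∧ σ (x ^ p ^ r) = ω * x ^ p ^ r := by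
  classical
  have hex : ∃ n, σ (x ^ p ^ n) = x ^ p ^ n := ⟨n, hn⟩
  -- Just below the least fixed power, the `σ`-quotient is not 1 but its `p`-th power is.
  obtain ⟨r, hr⟩ : ∃ r, Nat.find hex = r + 1 := by
    refine Nat.exists_eq_succ_of_ne_zero fun h ↦ hx ?_
    have h1 := Nat.find_spec hex
    rwa [h, pow_zero, pow_one] at h1
  have h1 : σ (x ^ p ^ r) ≠ x ^ p ^ r := Nat.find_min hex (by omega)
  have h2 : σ (x ^ p ^ (r + 1)) = x ^ p ^ (r + 1) := hr ▸ Nat.find_spec hex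
  have h0 : x ^ p ^ r ≠ 0 := pow_ne_zero _ hx0
  refine ⟨r, σ (x ^ p ^ r) / x ^ p ^ r, ?_, (div_mul_cancel₀ _ h0).symm⟩
  refine isPrimitiveRoot_of_pow_eq_one_of_ne_one hp ?_ (by rwa [Ne, div_eq_one_iff_eq h0])
  rw [div_pow, ← map_pow, ← pow_mul, ← pow_succ, h2, div_self (pow_ne_zero _ hx0)]

/-- An element whose `σ`-quotient is a root of unity of `p`-power order is either fixed by `σ`
or an eigenvector for a primitive `p`-th root of unity. -/
theorem apply_eq_self_or_eq_mul [FiniteDimensional k L] [IsGalois k L] (hp : p.Prime) (hp2 : p ≠ 2)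
    (hdeg : Module.finrank k L = p) (σ : L ≃ₐ[k] L) {A ε : L} (hA : A ≠ 0) (hε : σ A = ε * A)
    {n : ℕ} (hn : ε ^ p ^ n = 1) : σ A = A ∨ (IsPrimitiveRoot ε p ∧ σ A = ε * A) := by
  have hε0 : ε ≠ 0 := by
    rintro rfl
    simp [hp.ne_zero] at hn
  have hfix : σ ε = ε := by
    by_contra hne
    obtain ⟨r, ω, hω, hr⟩ := exists_pow_apply_eq_mul hp σ hε0 hne (n := n) (by rw [hn, map_one])
    have hσω := algEquiv_apply_eq_self_of_pow_eq_one hp hdeg σ hω.pow_eq_one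
    set t := ε ^ p ^ r
    set B := A ^ p ^ r with hBdef
    have hB : σ B = t * B := by rw [hBdef, map_pow, hε, mul_pow]
    have hB0 : B ≠ 0 := pow_ne_zero _ hA
    -- At `i = p` the left side is `B`, and the exponent `p(p-1)/2` is divisible by the odd prime
    -- `p`. Hence `t ^ p = 1`, so `σ` fixes `t`, against `σ t = ω * t`.
    have hpow : ∀ i : ℕ, (σ ^ i) B = ω ^ (∑ j ∈ Finset.range i, j) * t ^ i * B := by
      intro i
      induction i with
      | zero => simp
      | succ i ih =>
        rw [pow_succ', AlgEquiv.mul_apply, ih, map_mul, map_mul, map_pow, map_pow, hσω, hr, hB,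
          Finset.sum_range_succ]
        ring
    have hsum : p ∣ ∑ j ∈ Finset.range p, j := by
      rw [Finset.sum_range_id]
      obtain ⟨m, hm⟩ := hp.odd_of_ne_two hp2
      refine ⟨m, ?_⟩
      rw [show p - 1 = m * 2 by omega, ← mul_assoc, Nat.mul_div_cancel _ two_pos]
    have h1 := hpow p
    rw [algEquiv_pow_apply_eq_self hdeg, (hω.pow_eq_one_iff_dvd _).2 hsum, one_mul,
      eq_comm, mul_eq_right₀ hB0] at h1
    have h2 := algEquiv_apply_eq_self_of_pow_eq_one hp hdeg σ h1
    rw [hr, mul_eq_right₀ (pow_ne_zero _ hε0)] at h2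
    exact hω.ne_one hp.one_lt h2
  have hpow : ∀ i : ℕ, (σ ^ i) A = ε ^ i * A := by
    intro i
    induction i with
    | zero => simp
    | succ i ih =>
      rw [pow_succ', AlgEquiv.mul_apply, ih, map_mul, map_pow, hfix, hε]
      ring
  have h1 := hpow p
  rw [algEquiv_pow_apply_eq_self hdeg, eq_comm, mul_eq_right₀ hA] at h1
  rcases eq_or_ne ε 1 with rfl | hne
  · exact .inl (by rw [hε, one_mul])
  · exact .inr ⟨isPrimitiveRoot_of_pow_eq_one_of_ne_one hp h1 hne, hε⟩

end CyclicDegreeP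

theorem ringEquivOfRingEquiv_coeIdeal {A B : Type*} (K L : Type*) [CommRing A] [IsDomain A]
    [CommRing B] [IsDomain B] [Field K] [Field L] [Algebra A K] [Algebra B L]
    [IsFractionRing A K] [IsFractionRing B L] (f : A ≃+* B) (I : Ideal A) :
    FractionalIdeal.ringEquivOfRingEquiv K L f (I : FractionalIdeal A⁰ K) =
      (I.map f : FractionalIdeal B⁰ L) := by
  ext x
  rw [FractionalIdeal.ringEquivOfRingEquiv_apply]
  change x ∈ Submodule.map _ _ ↔ _
  rw [Submodule.mem_map, FractionalIdeal.mem_coeIdeal]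
  constructor
  · rintro ⟨y, hy, rfl⟩
    obtain ⟨a, ha, rfl⟩ := (FractionalIdeal.mem_coeIdeal _).1 hy
    exact ⟨f a, Ideal.mem_map_of_mem _ ha,
      (IsFractionRing.semilinearEquivOfRingEquiv_algebraMap K L f a).symm⟩
  · rintro ⟨b, hb, rfl⟩
    obtain ⟨a, ha, rfl⟩ := (Ideal.mem_map_of_equiv f b).1 hb
    exact ⟨algebraMap A K a, (FractionalIdeal.mem_coeIdeal _).2 ⟨a, ha, rfl⟩,
      IsFractionRing.semilinearEquivOfRingEquiv_algebraMap K L f a⟩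

/-! ### Complex conjugation on CM-fields, units and ideal classes. -/

section ComplexConjugation

variable {k L : Type*} [Field k] [NumberField k] [IsCMField k] [Field L] [NumberField L]
  [IsCMField L] [Algebra k L]

open IsCMField

theorem complexConj_algebraMap (x : k) :
    complexConj L (algebraMap k L x) = algebraMap k L (complexConj k x) := by
  obtain ⟨φ⟩ : Nonempty (L →+* ℂ) := inferInstance
  apply φ.injective
  rw [complexEmbedding_complexConj]
  exact (complexEmbedding_complexConj k (φ.comp (algebraMap k L)) x).symm

/-- Every complex embedding, including `φ ∘ τ`, turns `J` into conjugation on `ℂ`. -/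
theorem complexConj_ringHom_apply (τ : L →+* L) (x : L) :
    complexConj L (τ x) = τ (complexConj L x) := by
  obtain ⟨φ⟩ : Nonempty (L →+* ℂ) := inferInstance
  apply φ.injective
  rw [complexEmbedding_complexConj]
  exact (complexEmbedding_complexConj L (φ.comp τ) x).symm

theorem complexConj_mul_self_of_pow_eq_one {x : L} {n : ℕ} (hn : n ≠ 0) (hx : x ^ n = 1) :
    x * complexConj L x = 1 := by
  obtain ⟨φ⟩ : Nonempty (L →+* ℂ) := inferInstance
  apply φ.injective
  rw [map_mul, complexEmbedding_complexConj, map_one, Complex.mul_conj,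
    Complex.normSq_eq_norm_sq, Complex.norm_eq_one_of_pow_eq_one (by rw [← map_pow, hx, map_one])
      hn]
  simp

theorem exists_pow_eq_one_of_mul_complexConj {x : L} (hx : IsIntegral ℤ x)
    (h : x * complexConj L x = 1) : ∃ n, 0 < n ∧ x ^ n = 1 := by
  obtain ⟨n, hn, h1⟩ := Embeddings.pow_eq_one_of_norm_eq_one L ℂ hx fun φ ↦ by
    have h2 := congrArg φ h
    rw [map_mul, complexEmbedding_complexConj, map_one, Complex.mul_conj,
      Complex.normSq_eq_norm_sq] at h2
    have h3 : ‖φ x‖ ^ 2 = 1 := by exact_mod_cast h2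
    exact (pow_eq_one_iff_of_nonneg (norm_nonneg _) two_ne_zero).1 h3
  exact ⟨n, hn, h1⟩

/-- The quotient of a unit by its complex conjugate is a root of unity. -/
theorem exists_pow_unit_div_complexConj_eq_one (u : (𝓞 L)ˣ) :
    ∃ n, 0 < n ∧ ((u : L) / complexConj L (u : L)) ^ n = 1 := by
  have h0 : ((u : 𝓞 L) : L) ≠ 0 := by simp
  have h0' : complexConj L ((u : 𝓞 L) : L) ≠ 0 := by simp
  apply exists_pow_eq_one_of_mul_complexConj
  · let v := Units.map (ringOfIntegersComplexConj L : 𝓞 L →* 𝓞 L) u⁻¹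
    have hv : (complexConj L ((u : 𝓞 L) : L))⁻¹ = ((v : 𝓞 L) : L) := by
      change _ = complexConj L ((u⁻¹ : (𝓞 L)ˣ) : L)
      simp
    rw [div_eq_mul_inv, hv, ← map_mul]
    exact RingOfIntegers.isIntegral_coe _
  · rw [map_div₀, complexConj_apply_apply]
    field_simp

theorem classConj_mk0 (I J : (Ideal (𝓞 k))⁰)
    (h : (J : Ideal (𝓞 k)) = (I : Ideal (𝓞 k)).map (ringOfIntegersComplexConj k).toRingEquiv) :
    classConj k (ClassGroup.mk0 I) = ClassGroup.mk0 J := by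
  rw [classConj, ClassGroup.mulEquiv]
  rw [MulEquiv.trans_apply, MulEquiv.trans_apply, MulEquiv.symm_apply_eq, ClassGroup.equiv_mk0,
    ClassGroup.equiv_mk0]
  erw [QuotientGroup.congr_mk']
  congr 1
  ext1
  rw [Units.coe_mapEquiv]
  simp only [FractionalIdeal.coe_mk0, h]
  exact ringEquivOfRingEquiv_coeIdeal _ _ _ _

end ComplexConjugation

/-! ### Extension of ideals from `k` to `L` and descent of generators. -/

section Extension

variable {k L : Type*} [Field k] [Field L] [Algebra k L]

theorem exists_unit_coe_eq_of_pow_eq_one {x : L} {n : ℕ} (hn : n ≠ 0) (hx : x ^ n = 1) :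
    ∃ u : (𝓞 L)ˣ, (algebraMap (𝓞 L) L u) = x := by
  have hx' : IsIntegral ℤ x := 
    ⟨Polynomial.X ^ n - 1, Polynomial.monic_X_pow_sub_C 1 hn, by simp [hx]⟩
  obtain ⟨y, rfl⟩ : ∃ y : 𝓞 L, algebraMap (𝓞 L) L y = x := ⟨⟨x, hx'⟩, rfl⟩
  exact ⟨Units.ofPowEqOne y n (RingOfIntegers.ext (by simpa using hx)) hn, rfl⟩

/-- A generator of an ideal extended from `k` changes by a unit under an automorphism over `k`. -/
theorem exists_unit_apply_eq_mul (σ : L ≃ₐ[k] L) {I : Ideal (𝓞 k)} {y : 𝓞 L}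
    (hI : I.map (algebraMap (𝓞 k) (𝓞 L)) = Ideal.span {y}) :
    ∃ u : (𝓞 L)ˣ, σ (algebraMap (𝓞 L) L y) = (algebraMap (𝓞 L) L u) * (algebraMap (𝓞 L) L y) := by
  have h1 : (I.map (algebraMap (𝓞 k) (𝓞 L))).map (RingOfIntegers.mapAlgHom σ : 𝓞 L →ₐ[𝓞 k] 𝓞 L) =
      I.map (algebraMap (𝓞 k) (𝓞 L)) := by
    rw [← Ideal.map_coe (RingOfIntegers.mapAlgHom σ : 𝓞 L →ₐ[𝓞 k] 𝓞 L), Ideal.map_map]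
    congr 1
    exact AlgHom.comp_algebraMap _
  rw [hI, Ideal.map_span, Set.image_singleton, Ideal.span_singleton_eq_span_singleton] at h1
  obtain ⟨u, hu⟩ := h1.symm
  refine ⟨u, ?_⟩
  rw [← map_mul, mul_comm, hu]
  rfl

variable [NumberField k] [NumberField L]

variable (L) in
theorem map_algebraMap_ringOfIntegers_injective :
    Function.Injective (Ideal.map (algebraMap (𝓞 k) (𝓞 L))) := by
  intro I J h
  apply FractionalIdeal.coeIdeal_injective (K := k)
  apply FractionalIdeal.extendedHom_injective (𝓞 k) k L (𝓞 L)
  simp only [FractionalIdeal.extendedHom_coeIdeal_eq_map, h]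

/-- If the extension of `I` to `L` is generated by an associate of `g ∈ k`, then `g` generates
`I`. -/
theorem exists_span_singleton_eq_of_map_eq {I : Ideal (𝓞 k)} {Y : 𝓞 L}
    (hI : I.map (algebraMap (𝓞 k) (𝓞 L)) = Ideal.span {Y}) (u : (𝓞 L)ˣ) {g : k}
    (hY : algebraMap (𝓞 L) L Y = (algebraMap (𝓞 L) L u) * algebraMap k L g) :
    ∃ g₀ : 𝓞 k, algebraMap (𝓞 k) k g₀ = g ∧ I = Ideal.span {g₀} := by
  have h1 : algebraMap (𝓞 L) L (u⁻¹ * Y) = algebraMap k L g := by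
    rw [map_mul, hY, ← mul_assoc, ← map_mul, Units.inv_mul, map_one, one_mul]
  have h2 : IsIntegral ℤ g := by
    rw [← isIntegral_algebraMap_iff (algebraMap k L).injective, ← h1]
    exact RingOfIntegers.isIntegral_coe _
  obtain ⟨g₀, rfl⟩ : ∃ g₀ : 𝓞 k, algebraMap (𝓞 k) k g₀ = g := ⟨⟨g, h2⟩, rfl⟩
  refine ⟨g₀, rfl, map_algebraMap_ringOfIntegers_injective L ?_⟩
  have h3 : algebraMap (𝓞 k) (𝓞 L) g₀ = u⁻¹ * Y := by
    apply RingOfIntegers.ext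
    exact h1.symm
  rw [hI, Ideal.map_span, Set.image_singleton, h3, Ideal.span_singleton_mul_left_unit u⁻¹.isUnit]

/-- The relative norm of an extended ideal is its power by the degree, and norms of principal ideals
are principal. -/
theorem exists_pow_finrank_eq_span {A B : Type*} (K M : Type*) [CommRing A] [IsDedekindDomain A]
    [CommRing B] [IsDedekindDomain B] [Algebra A B] [Module.Finite A B] [Module.IsTorsionFree A B]
    [Field K] [Field M] [Algebra A K] [IsFractionRing A K] [Algebra B M] [IsFractionRing B M]
    [Algebra K M] [Algebra A M] [IsScalarTower A K M] [IsScalarTower A B M]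
    {I : Ideal A} {y : B} (hy : I.map (algebraMap A B) = Ideal.span {y}) :
    ∃ z : A, I ^ Module.finrank K M = Ideal.span {z} := by
  have h := Ideal.relNorm_algebraMap B I
  rw [hy, Ideal.relNorm_singleton, ← IsFractionRing.finrank_eq A K B M] at h
  exact ⟨_, h.symm⟩

theorem mk0_mem_kappa_iff (I : (Ideal (𝓞 k))⁰) :
    ClassGroup.mk0 I ∈ kappa k L ↔
      ∃ y : 𝓞 L, (I : Ideal (𝓞 k)).map (algebraMap (𝓞 k) (𝓞 L)) = Ideal.span {y} := by
  rw [kappa, MonoidHom.mem_ker, ClassGroup.extendedHom_mk0, ClassGroup.mk0_eq_one_iff,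
    Submodule.isPrincipal_iff]

theorem pow_finrank_eq_one_of_mem_kappa {c : ClassGroup (𝓞 k)} (hc : c ∈ kappa k L) :
    c ^ Module.finrank k L = 1 := by
  obtain ⟨I, rfl⟩ := ClassGroup.mk0_surjective c
  obtain ⟨y, hy⟩ := (mk0_mem_kappa_iff I).1 hc
  obtain ⟨z, hz⟩ := exists_pow_finrank_eq_span k L hy
  rw [← SubmonoidClass.coe_pow] at hz
  rw [← map_pow]
  generalize I ^ Module.finrank k L = J at hz
  exact (ClassGroup.mk0_eq_one_iff J.2).2 ⟨z, hz⟩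

end Extension

/-! ### Each of the three conditions kills the minus part of the capitulation kernel. -/

section CM

open IsCMField

variable {k L : Type*} [Field k] [NumberField k] [IsCMField k] [Field L] [NumberField L]
  [IsCMField L] [Algebra k L]

/-- The complex conjugate of a nonzero ideal. -/
noncomputable def conjIdeal (I : (Ideal (𝓞 k))⁰) : (Ideal (𝓞 k))⁰ :=
  ⟨(I : Ideal (𝓞 k)).map (ringOfIntegersComplexConj k).toRingEquiv,
    mem_nonZeroDivisors_iff_ne_zero.2 fun h ↦ nonZeroDivisors.coe_ne_zero I <|
      (Ideal.map_eq_bot_iff_of_injective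
        (ringOfIntegersComplexConj k).toRingEquiv.injective).1 h⟩

theorem mk0_mem_minusClassGroup_iff (I : (Ideal (𝓞 k))⁰) :
    ClassGroup.mk0 I ∈ minusClassGroup k ↔
      ∃ g : 𝓞 k, ((I * conjIdeal I : (Ideal (𝓞 k))⁰) : Ideal (𝓞 k)) = Ideal.span {g} := by
  rw [minusClassGroup, MonoidHom.mem_ker]
  change ClassGroup.mk0 I * classConj k (ClassGroup.mk0 I) = 1 ↔ _
  rw [classConj_mk0 I (conjIdeal I) rfl, ← map_mul, ClassGroup.mk0_eq_one_iff (I * conjIdeal I).2,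
    Submodule.isPrincipal_iff]

theorem map_mul_conjIdeal {I : (Ideal (𝓞 k))⁰} {y : 𝓞 L}
    (hI : (I : Ideal (𝓞 k)).map (algebraMap (𝓞 k) (𝓞 L)) = Ideal.span {y}) :
    ((I * conjIdeal I : (Ideal (𝓞 k))⁰) : Ideal (𝓞 k)).map (algebraMap (𝓞 k) (𝓞 L)) =
      Ideal.span {y * ringOfIntegersComplexConj L y} := by
  have h1 : (conjIdeal I : Ideal (𝓞 k)).map (algebraMap (𝓞 k) (𝓞 L)) =
      ((I : Ideal (𝓞 k)).map (algebraMap (𝓞 k) (𝓞 L))).map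
        (ringOfIntegersComplexConj L : 𝓞 L →+* 𝓞 L) := by
    change ((I : Ideal (𝓞 k)).map
      ((ringOfIntegersComplexConj k).toRingEquiv : 𝓞 k →+* 𝓞 k)).map _ = _
    rw [Ideal.map_map, Ideal.map_map]
    congr 1
    ext x
    exact (complexConj_algebraMap (x : k)).symm
  rw [Submonoid.coe_mul, Ideal.map_mul, h1, hI, Ideal.map_span, Set.image_singleton,
    Ideal.span_singleton_mul_span_singleton]
  rfl

variable {p : ℕ}

/-- A minus class `c` in the capitulation kernel becomes, after raising to a power prime to `p`,
generated in `L` by an element `A` (up to `kˣ` and units) on which `σ` acts through a root of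
unity of `p`-power order. -/
theorem exists_generator_of_mem_kappaMinus (hp : p.Prime) (hp2 : p ≠ 2) (σ : L ≃ₐ[k] L)
    {c : ClassGroup (𝓞 k)} (hc : c ∈ kappaMinus k L) :
    ∃ (I : (Ideal (𝓞 k))⁰) (m : ℕ) (Y : 𝓞 L) (v : (𝓞 L)ˣ) (A ε : L) (G : k) (n : ℕ),
      m.Coprime p ∧ c ^ m = ClassGroup.mk0 I ∧
      (I : Ideal (𝓞 k)).map (algebraMap (𝓞 k) (𝓞 L)) = Ideal.span {Y} ∧ A ≠ 0 ∧ G ≠ 0 ∧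
      algebraMap (𝓞 L) L Y = algebraMap (𝓞 L) L v * (A * algebraMap k L G) ∧
      σ A = ε * A ∧ ε ^ p ^ n = 1 := by
  obtain ⟨I, rfl⟩ := ClassGroup.mk0_surjective c
  obtain ⟨y, hy⟩ := (mk0_mem_kappa_iff (L := L) I).1 hc.1
  obtain ⟨g, hg⟩ := (mk0_mem_minusClassGroup_iff I).1 hc.2
  have hy0 : algebraMap (𝓞 L) L y ≠ 0 := by
    intro h
    rw [RingOfIntegers.coe_eq_zero_iff] at h
    rw [h, Ideal.span_singleton_zero, Ideal.map_eq_bot_iff_of_injective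
      (FaithfulSMul.algebraMap_injective _ _)] at hy
    exact nonZeroDivisors.coe_ne_zero I hy
  have hJ0 : complexConj L (algebraMap (𝓞 L) L y) ≠ 0 := by simpa using hy0
  have hyy := map_mul_conjIdeal hy
  rw [hg, Ideal.map_span, Set.image_singleton, Ideal.span_singleton_eq_span_singleton] at hyy
  obtain ⟨v, hv⟩ := hyy
  have hv' : algebraMap (𝓞 L) L y * complexConj L (algebraMap (𝓞 L) L y) =
      algebraMap (𝓞 L) L v * algebraMap k L (algebraMap (𝓞 k) k g) := by
    have := congrArg (algebraMap (𝓞 L) L) hv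
    simp only [map_mul] at this
    rw [mul_comm (algebraMap (𝓞 L) L v)]
    exact this.symm
  have hg0 : algebraMap (𝓞 k) k g ≠ 0 := by
    intro h
    rw [h, map_zero, mul_zero] at hv'
    exact mul_ne_zero hy0 hJ0 hv'
  obtain ⟨u, hu⟩ := exists_unit_apply_eq_mul σ hy
  obtain ⟨N, hN, hN1⟩ := exists_pow_unit_div_complexConj_eq_one u
  obtain ⟨n, m, hm, rfl⟩ := Nat.exists_eq_pow_mul_and_not_dvd hN.ne' p hp.ne_one
  have hσJ : σ (complexConj L (algebraMap (𝓞 L) L y)) =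
      complexConj L (algebraMap (𝓞 L) L u) * complexConj L (algebraMap (𝓞 L) L y) := by
    rw [← map_mul, ← hu]
    exact (complexConj_ringHom_apply (σ : L →+* L) (algebraMap (𝓞 L) L y)).symm
  -- The factor 2 comes from `y ^ 2 = (y / J y) * (y * J y)`; `m` removes the prime-to-`p` part of
  -- an exponent killing `u / J u`.
  refine ⟨I ^ (2 * m), 2 * m, y ^ (2 * m), v ^ m, (y / complexConj L (algebraMap (𝓞 L) L y)) ^ m,
    (u / complexConj L (algebraMap (𝓞 L) L u)) ^ m, algebraMap (𝓞 k) k g ^ m, n, ?_,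
    (map_pow _ _ _).symm, ?_,
    pow_ne_zero _ (div_ne_zero hy0 hJ0), pow_ne_zero _ hg0, ?_, ?_, ?_⟩
  · exact Nat.Coprime.mul_left ((Nat.coprime_primes Nat.prime_two hp).2 hp2.symm)
      ((Nat.Prime.coprime_iff_not_dvd hp).2 hm).symm
  · rw [SubmonoidClass.coe_pow, Ideal.map_pow, hy, Ideal.span_singleton_pow]
  · rw [Units.val_pow_eq_pow_val, map_pow, map_pow, map_pow, ← mul_pow, ← mul_pow, pow_mul]
    congr 1
    rw [mul_left_comm, ← hv']
    field_simp
  · rw [← mul_pow, map_pow, map_div₀, hu, hσJ]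
    congr 1
    rw [mul_div_mul_comm]
  · rw [← pow_mul, mul_comm, hN1]

theorem eq_one_of_pow_coprime {G : Type*} [Group G] {c : G} {m p : ℕ} (h : m.Coprime p)
    (hm : c ^ m = 1) (hp : c ^ p = 1) : c = 1 := by
  have := Nat.dvd_gcd (orderOf_dvd_of_pow_eq_one hm) (orderOf_dvd_of_pow_eq_one hp)
  rw [h, Nat.dvd_one] at this
  exact orderOf_eq_one_iff.1 this

theorem kappaMinus_eq_bot [IsGalois k L] (hp : p.Prime) (hp2 : p ≠ 2)
    (hdeg : Module.finrank k L = p) {σ : L ≃ₐ[k] L}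
    (hσ : ∀ τ : L ≃ₐ[k] L, τ ∈ Subgroup.zpowers σ)
    (h : (¬ ∃ ζ : k, IsPrimitiveRoot ζ p) ∨
      ((∃ ζ : k, IsPrimitiveRoot ζ p) ∧
        ∃ n : ℕ, 2 ≤ n ∧ IsGeneratedByRootOfUnity (p ^ n) k L) ∨
      ((∃ ζ : k, IsPrimitiveRoot ζ p) ∧ IsEssentiallyRamified p k L)) :
    kappaMinus k L = ⊥ := by
  have hp' : NeZero p := ⟨hp.ne_zero⟩
  rw [eq_bot_iff]
  intro c hc
  obtain ⟨I, m, Y, v, A, ε, G, n, hm, hcI, hI, hA, hG, hY, hσA, hε⟩ :=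
    exists_generator_of_mem_kappaMinus hp hp2 σ hc
  -- If `A` is fixed up to a unit, `I` is principal, so `c ^ m = 1`; also `c ^ p = 1` by the norm.
  have key : ∀ (w : (𝓞 L)ˣ) (x : L), algebraMap (𝓞 L) L w * x = A → σ x = x → c = 1 := by
    intro w x hx hfix
    obtain ⟨a, rfl⟩ := exists_algebraMap_eq_of_generator_fixed hσ hfix
    obtain ⟨g₀, -, hg₀⟩ := exists_span_singleton_eq_of_map_eq hI (v * w) (g := a * G)
      (by rw [hY, ← hx, Units.val_mul, map_mul, map_mul]; ring)
    refine eq_one_of_pow_coprime hm ?_ (hdeg ▸ pow_finrank_eq_one_of_mem_kappa hc.1)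
    rw [hcI]
    exact (ClassGroup.mk0_eq_one_iff I.2).2 ⟨g₀, hg₀⟩
  rw [Subgroup.mem_bot]
  rcases apply_eq_self_or_eq_mul hp hp2 hdeg σ hA hσA hε with h0 | ⟨hprim, -⟩
  · exact key 1 A (by simp) h0
  have hε0 : ε ≠ 0 := hprim.ne_zero hp.ne_zero
  rcases h with h | ⟨-, N, -, ξ, hξ, hgen⟩ | ⟨-, γ, ⟨y, hy, hgen⟩, hγ⟩
  · obtain ⟨ζ, rfl⟩ := exists_algebraMap_eq_of_generator_fixed hσ
      (algEquiv_apply_eq_self_of_pow_eq_one hp hdeg σ hprim.pow_eq_one)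
    exact (h ⟨ζ, hprim.of_map_of_injective (algebraMap k L).injective⟩).elim
  · have hξ0 : ξ ≠ 0 := hξ.ne_zero (pow_ne_zero _ hp.ne_zero)
    obtain ⟨r, ω, hω, hr⟩ := exists_pow_apply_eq_mul hp σ hξ0
      (exists_generator_apply_ne hp hdeg hσ hgen) (n := N) (by rw [hξ.pow_eq_one, map_one])
    obtain ⟨j, -, hj⟩ := hω.eq_pow_of_pow_eq_one hprim.pow_eq_one
    obtain ⟨w, hw⟩ := exists_unit_coe_eq_of_pow_eq_one (x := (ξ ^ p ^ r) ^ j)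
      (pow_ne_zero N hp.ne_zero)
      (by rw [← pow_mul, ← pow_mul, ← mul_assoc, mul_comm, pow_mul, hξ.pow_eq_one, one_pow])
    have hw0 : (ξ ^ p ^ r) ^ j ≠ 0 := pow_ne_zero _ (pow_ne_zero _ hξ0)
    -- The unit `(ξ ^ p ^ r) ^ j` has the same eigenvalue `ε` as `A`.
    refine key w (A / (ξ ^ p ^ r) ^ j) (by rw [hw, mul_div_cancel₀ _ hw0]) ?_
    rw [map_div₀, hσA, map_pow, hr, mul_pow, hj, mul_div_mul_left _ _ hε0]
  · exfalso
    apply hγ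
    have hy0 : y ≠ 0 := by
      rintro rfl
      exact exists_generator_apply_ne hp hdeg hσ hgen (map_zero σ)
    have hω1 : (σ y / y) ^ p = 1 := by
      rw [div_pow, ← map_pow, hy, AlgEquiv.commutes, ← hy, div_self (pow_ne_zero _ hy0)]
    obtain ⟨j, -, hj⟩ := hprim.eq_pow_of_pow_eq_one hω1
    -- Kummer theory: `y` and `A ^ j` share an eigenvalue, so they differ by a factor in `k`. Since
    -- `A ^ p * G ^ p` generates `I ^ p`, the ideal of `γ` is a `p`-th power.
    obtain ⟨b, hb⟩ := exists_algebraMap_eq_of_generator_fixed hσ (x := y / A ^ j) (by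
      rw [map_div₀, map_pow, hσA, mul_pow, hj, div_mul_eq_div_div, div_div_cancel₀]
      exact (map_ne_zero σ).2 hy0)
    obtain ⟨a, ha⟩ := exists_algebraMap_eq_of_generator_fixed hσ (x := A ^ p) (by
      rw [map_pow, hσA, mul_pow, hprim.pow_eq_one, one_mul])
    obtain ⟨g₀, hg₀, hIg⟩ := exists_span_singleton_eq_of_map_eq (I := (I : Ideal (𝓞 k)) ^ p)
      (Y := Y ^ p) (by rw [Ideal.map_pow, hI, Ideal.span_singleton_pow]) (v ^ p) (g := a * G ^ p)
      (by rw [map_pow, hY, map_mul, ha, Units.val_pow_eq_pow_val, map_pow, map_pow]; ring)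
    have hγ' : γ = (b * (G ^ j)⁻¹) ^ p * (algebraMap (𝓞 k) k g₀) ^ j := by
      apply (algebraMap k L).injective
      have hy' : y = algebraMap k L b * A ^ j := by
        rw [hb, div_mul_cancel₀ _ (pow_ne_zero _ hA)]
      have hG' : algebraMap k L G ≠ 0 := by simpa using hG
      rw [← hy, hy', hg₀]
      simp only [map_mul, map_pow, map_inv₀, ha]
      rw [mul_pow, mul_pow, mul_pow, inv_pow, pow_right_comm A j p, pow_right_comm _ j p]
      field_simp
    refine ⟨FractionalIdeal.spanSingleton _ (b * (G ^ j)⁻¹) *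
      ((I : Ideal (𝓞 k)) : FractionalIdeal (𝓞 k)⁰ k) ^ j, ?_⟩
    rw [hγ', ← FractionalIdeal.spanSingleton_mul_spanSingleton,
      ← FractionalIdeal.spanSingleton_pow, ← FractionalIdeal.spanSingleton_pow, mul_pow,
      pow_right_comm,
      ← FractionalIdeal.coeIdeal_pow, hIg, FractionalIdeal.coeIdeal_span_singleton]

end CM

/-! ### The converse: a nontrivial capitulating class from Kummer theory. -/

open IsCMField

variable {k L : Type*} [Field k] [NumberField k] [Field L] [NumberField L] [Algebra k L]
  {p : ℕ}

/-- A Kummer generator of `L` over `k` whose ideal is a `p`-th power yields an integral one. -/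
theorem exists_integral_kummer_generator [IsGalois k L] [IsCyclic (L ≃ₐ[k] L)] (hp : p.Prime)
    (hdeg : Module.finrank k L = p) {σ : L ≃ₐ[k] L}
    (hσ : ∀ τ : L ≃ₐ[k] L, τ ∈ Subgroup.zpowers σ) {ζ : k} (hζ : IsPrimitiveRoot ζ p)
    (h : ¬ IsEssentiallyRamified p k L) :
    ∃ (β : 𝓞 k) (𝔟 : (Ideal (𝓞 k))⁰) (x : 𝓞 L),
      x ^ p = algebraMap (𝓞 k) (𝓞 L) β ∧ σ (algebraMap (𝓞 L) L x) ≠ algebraMap (𝓞 L) L x ∧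
      Ideal.span {β} = (𝔟 : Ideal (𝓞 k)) ^ p := by
  obtain ⟨x₀, ⟨γ, hγ⟩, hgen⟩ := exists_root_adjoin_eq_top_of_isCyclic k L
    ⟨ζ, (mem_primitiveRoots (hdeg ▸ hp.pos)).2 (hdeg.symm ▸ hζ)⟩
  rw [hdeg] at hγ
  obtain ⟨𝔞, h𝔞⟩ : ∃ 𝔞 : FractionalIdeal (𝓞 k)⁰ k,
      FractionalIdeal.spanSingleton (𝓞 k)⁰ γ = 𝔞 ^ p := by
    by_contra hcon
    exact h ⟨γ, ⟨x₀, hγ.symm, hgen⟩, hcon⟩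
  have hx₀ := exists_generator_apply_ne hp hdeg hσ hgen
  -- Scaling `γ` by the `p`-th power of the denominator of `𝔞` makes the ideal integral without
  -- changing the Kummer extension.
  have hspan : FractionalIdeal.spanSingleton (𝓞 k)⁰ (algebraMap (𝓞 k) k 𝔞.den ^ p * γ) =
      ((𝔞.num ^ p : Ideal (𝓞 k)) : FractionalIdeal (𝓞 k)⁰ k) := by
    rw [← FractionalIdeal.spanSingleton_mul_spanSingleton, h𝔞,
      ← FractionalIdeal.spanSingleton_pow, ← mul_pow, FractionalIdeal.den_mul_self_eq_num',
      FractionalIdeal.coeIdeal_pow]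
  obtain ⟨β, -, hβ⟩ := (FractionalIdeal.mem_coeIdeal _).1
    (hspan ▸ FractionalIdeal.mem_spanSingleton_self (𝓞 k)⁰ (algebraMap (𝓞 k) k 𝔞.den ^ p * γ))
  have hβspan : Ideal.span {β} = 𝔞.num ^ p := by
    apply FractionalIdeal.coeIdeal_injective (K := k)
    change ((Ideal.span {β} : Ideal (𝓞 k)) : FractionalIdeal (𝓞 k)⁰ k) = _
    rw [FractionalIdeal.coeIdeal_span_singleton, hβ, hspan]
  have hxp : (algebraMap k L (algebraMap (𝓞 k) k 𝔞.den) * x₀) ^ p =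
      algebraMap k L (algebraMap (𝓞 k) k β) := by
    rw [hβ, mul_pow, ← hγ, map_mul, map_pow]
  have hint : IsIntegral ℤ (algebraMap k L (algebraMap (𝓞 k) k 𝔞.den) * x₀) := by
    refine IsIntegral.of_pow hp.pos ?_
    rw [hxp]
    exact (RingOfIntegers.isIntegral_coe β).map (algebraMap k L).toIntAlgHom
  obtain ⟨x, hx⟩ : ∃ x : 𝓞 L, algebraMap (𝓞 L) L x =
    algebraMap k L (algebraMap (𝓞 k) k 𝔞.den) * x₀ := ⟨⟨_, hint⟩, rfl⟩
  have hσx : σ (algebraMap (𝓞 L) L x) ≠ algebraMap (𝓞 L) L x := by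
    rw [hx, map_mul, AlgEquiv.commutes]
    exact fun h ↦ hx₀ (mul_left_cancel₀ (by simp) h)
  have hxβ : x ^ p = algebraMap (𝓞 k) (𝓞 L) β := by
    apply FaithfulSMul.algebraMap_injective (𝓞 L) L
    rw [map_pow, hx, hxp]
    rfl
  refine ⟨β, ⟨𝔞.num, mem_nonZeroDivisors_iff_ne_zero.2 fun h0 ↦ hσx ?_⟩, x, hxβ, hσx, hβspan⟩
  rw [h0, zero_pow hp.ne_zero, Ideal.zero_eq_bot, Ideal.span_singleton_eq_bot] at hβspan
  rw [hβspan, map_zero, pow_eq_zero_iff hp.ne_zero] at hxβ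
  rw [hxβ, map_zero, map_zero]

variable [IsCMField L]

/-- A unit of `L` that is an eigenvector of `σ` for a primitive `p`-th root of unity forces `L` to
be generated by a root of unity of `p`-power order. -/
theorem exists_isGeneratedByRootOfUnity_of_unit [IsGalois k L] (hp : p.Prime) (hp2 : p ≠ 2)
    (hdeg : Module.finrank k L = p) {σ : L ≃ₐ[k] L} {ω : L} (hω : IsPrimitiveRoot ω p)
    (u : (𝓞 L)ˣ) (hu : σ (algebraMap (𝓞 L) L u) = ω * algebraMap (𝓞 L) L u) :
    ∃ n : ℕ, 2 ≤ n ∧ IsGeneratedByRootOfUnity (p ^ n) k L := by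
  have hu0 : algebraMap (𝓞 L) L u ≠ 0 := by simp
  have hJ0 : complexConj L (algebraMap (𝓞 L) L u) ≠ 0 := (map_ne_zero _).2 hu0
  obtain ⟨N, hN, hN1⟩ := exists_pow_unit_div_complexConj_eq_one u
  obtain ⟨n, m, hm, rfl⟩ := Nat.exists_eq_pow_mul_and_not_dvd hN.ne' p hp.ne_one
  set ρ := algebraMap (𝓞 L) L u / complexConj L (algebraMap (𝓞 L) L u) with hρ
  have hρ0 : ρ ≠ 0 := div_ne_zero hu0 hJ0
  have hωJ := complexConj_mul_self_of_pow_eq_one hp.ne_zero hω.pow_eq_one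
  -- The eigenvalue is `ω / J ω`, and `J ω` is the inverse of `ω`.
  have hσρ : σ ρ = ω ^ 2 * ρ := by
    have h1 : σ (complexConj L (algebraMap (𝓞 L) L u)) =
        complexConj L ω * complexConj L (algebraMap (𝓞 L) L u) := by
      rw [← map_mul, ← hu]
      exact (complexConj_ringHom_apply (σ : L →+* L) _).symm
    have hω0 : complexConj L ω ≠ 0 := right_ne_zero_of_mul_eq_one hωJ
    rw [hρ, map_div₀, hu, h1, div_eq_iff (mul_ne_zero hω0 hJ0)]
    field_simp
    linear_combination (-ω) * hωJ
  have hne : σ (ρ ^ m) ≠ ρ ^ m := by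
    rw [map_pow, hσρ, mul_pow, ← pow_mul]
    intro h
    rw [mul_eq_right₀ (pow_ne_zero _ hρ0), hω.pow_eq_one_iff_dvd, hp.dvd_mul] at h
    exact h.elim (fun h ↦ hp2 ((Nat.prime_dvd_prime_iff_eq hp Nat.prime_two).1 h)) hm
  have h1 : (ρ ^ m) ^ p ^ n = 1 := by rw [← pow_mul, mul_comm, hN1]
  obtain ⟨e, -, he⟩ := (Nat.dvd_prime_pow hp).1 (orderOf_dvd_of_pow_eq_one h1)
  refine ⟨e, ?_, ρ ^ m, IsPrimitiveRoot.iff_orderOf.2 he, adjoin_eq_top_of_apply_ne hp hdeg hne⟩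
  -- If `e ≤ 1`, then `ρ ^ m` is a `p`-th root of unity, which `σ` would fix.
  by_contra! hlt
  apply hne
  apply algEquiv_apply_eq_self_of_pow_eq_one hp hdeg
  rw [← orderOf_dvd_iff_pow_eq_one, he]
  simpa using pow_dvd_pow p (show e ≤ 1 by omega)

variable [IsCMField k]

/-- The class is minus because `ω * J ω = 1` makes `x * J x` fixed by `σ`. Were `𝔟 = (c)`, then `x /
c` would be a unit with eigenvalue `ω`, and `L` would be generated by a root of unity as in `h₁`. -/
theorem exists_kummer_class_mem_kappaMinus [IsGalois k L] [IsCyclic (L ≃ₐ[k] L)] (hp : p.Prime)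
    (hp2 : p ≠ 2) (hdeg : Module.finrank k L = p) {ζ : k} (hζ : IsPrimitiveRoot ζ p)
    (h₁ : ¬ ∃ n : ℕ, 2 ≤ n ∧ IsGeneratedByRootOfUnity (p ^ n) k L)
    (h₂ : ¬ IsEssentiallyRamified p k L) :
    ∃ (β : 𝓞 k) (𝔟 : (Ideal (𝓞 k))⁰), IsGeneratedByRoot p L (algebraMap (𝓞 k) k β) ∧
      Ideal.span {β} = (𝔟 : Ideal (𝓞 k)) ^ p ∧ ClassGroup.mk0 𝔟 ∈ kappaMinus k L ∧
      ClassGroup.mk0 𝔟 ≠ 1 := by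
  obtain ⟨σ, hσ⟩ := IsCyclic.exists_generator (α := L ≃ₐ[k] L)
  obtain ⟨β, 𝔟, x, hx, hσx, hβ⟩ := exists_integral_kummer_generator hp hdeg hσ hζ h₂
  have hx0 : algebraMap (𝓞 L) L x ≠ 0 := fun h ↦ hσx (by rw [h, map_zero])
  have hxL : algebraMap (𝓞 L) L x ^ p = algebraMap k L (algebraMap (𝓞 k) k β) := by
    rw [← map_pow, hx]
    rfl
  obtain ⟨ω, hσω⟩ : ∃ ω, σ (algebraMap (𝓞 L) L x) = ω * algebraMap (𝓞 L) L x :=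
    ⟨_, (div_mul_cancel₀ _ hx0).symm⟩
  have hω : IsPrimitiveRoot ω p := by
    refine isPrimitiveRoot_of_pow_eq_one_of_ne_one hp ?_ ?_
    · have h3 : σ (algebraMap (𝓞 L) L x ^ p) = algebraMap (𝓞 L) L x ^ p := by
        rw [hxL, AlgEquiv.commutes]
      rwa [map_pow, hσω, mul_pow, mul_eq_right₀ (pow_ne_zero _ hx0)] at h3
    · rintro rfl
      exact hσx (by rw [hσω, one_mul])
  -- Both ideals have `p`-th power `(β)`, and unique factorization allows cancelling the exponent.
  have hmap : (𝔟 : Ideal (𝓞 k)).map (algebraMap (𝓞 k) (𝓞 L)) = Ideal.span {x} := by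
    have h3 : (𝔟 : Ideal (𝓞 k)).map (algebraMap (𝓞 k) (𝓞 L)) ^ p = Ideal.span {x} ^ p := by
      rw [← Ideal.map_pow, ← hβ, Ideal.map_span, Set.image_singleton, ← hx,
        Ideal.span_singleton_pow]
    exact dvd_antisymm
      ((UniqueFactorizationMonoid.pow_dvd_pow_iff_dvd hp.ne_zero).1 h3.dvd)
      ((UniqueFactorizationMonoid.pow_dvd_pow_iff_dvd hp.ne_zero).1 h3.symm.dvd)
  refine ⟨β, 𝔟, ⟨_, hxL, adjoin_eq_top_of_apply_ne hp hdeg hσx⟩, hβ,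
    ⟨(mk0_mem_kappa_iff 𝔟).2 ⟨x, hmap⟩, ?_⟩, ?_⟩
  · have hωJ := complexConj_mul_self_of_pow_eq_one hp.ne_zero hω.pow_eq_one
    obtain ⟨g, hg⟩ := exists_algebraMap_eq_of_generator_fixed hσ
      (x := algebraMap (𝓞 L) L x * complexConj L (algebraMap (𝓞 L) L x)) (by
        have h3 : σ (complexConj L (algebraMap (𝓞 L) L x)) =
            complexConj L (σ (algebraMap (𝓞 L) L x)) :=
          (complexConj_ringHom_apply (σ : L →+* L) _).symm
        rw [map_mul, h3, hσω, map_mul, mul_mul_mul_comm, hωJ, one_mul])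
    obtain ⟨g₀, -, hg₀⟩ := exists_span_singleton_eq_of_map_eq (map_mul_conjIdeal hmap) 1 (g := g)
      (by rw [hg, Units.val_one, map_one, one_mul, map_mul]; rfl)
    exact (mk0_mem_minusClassGroup_iff 𝔟).2 ⟨g₀, hg₀⟩
  · intro h1
    obtain ⟨c, hc⟩ := (Submodule.isPrincipal_iff _).1 ((ClassGroup.mk0_eq_one_iff 𝔟.2).1 h1)
    change _ = Ideal.span {c} at hc
    rw [hc, Ideal.map_span, Set.image_singleton, Ideal.span_singleton_eq_span_singleton] at hmap
    obtain ⟨u, hu⟩ := hmap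
    have hu' : algebraMap (𝓞 L) L x =
        algebraMap k L (algebraMap (𝓞 k) k c) * algebraMap (𝓞 L) L u := by
      rw [← hu, map_mul]
      rfl
    apply h₁
    refine exists_isGeneratedByRootOfUnity_of_unit hp hp2 hdeg hω u (σ := σ) ?_
    rw [hu', map_mul, AlgEquiv.commutes, mul_left_comm] at hσω
    exact mul_left_cancel₀ (left_ne_zero_of_mul (hu' ▸ hx0)) hσω

end Capitulation

theorem theorem3 (p : ℕ) (hp : p.Prime) (hp2 : p ≠ 2)
    (k L : Type*) [Field k] [NumberField k] [IsCMField k]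
    [Field L] [NumberField L] [IsCMField L] [Algebra k L]
    [IsGalois k L] [IsCyclic (L ≃ₐ[k] L)] (hdeg : Module.finrank k L = p) :
    (Capitulation.kappaMinus k L = ⊥ ↔
      (¬ ∃ ζ : k, IsPrimitiveRoot ζ p) ∨
      ((∃ ζ : k, IsPrimitiveRoot ζ p) ∧
        ∃ n : ℕ, 2 ≤ n ∧ Capitulation.IsGeneratedByRootOfUnity (p ^ n) k L) ∨
      ((∃ ζ : k, IsPrimitiveRoot ζ p) ∧ Capitulation.IsEssentiallyRamified p k L)) ∧
    (Nat.card (Capitulation.kappaMinus k L) = p →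
      ∃ (β : 𝓞 k) (𝔟 : (Ideal (𝓞 k))⁰),
        Capitulation.IsGeneratedByRoot p L (β : k) ∧
        Ideal.span {β} = (𝔟 : Ideal (𝓞 k)) ^ p ∧
        Capitulation.kappaMinus k L = Subgroup.zpowers (ClassGroup.mk0 𝔟)) := by
  obtain ⟨σ, hσ⟩ := IsCyclic.exists_generator (α := L ≃ₐ[k] L)
  have htriv := Capitulation.kappaMinus_eq_bot hp hp2 hdeg hσ
  refine ⟨⟨fun hbot ↦ ?_, htriv⟩, fun hcard ↦ ?_⟩
  · by_contra hcon
    rw [not_or, not_or, not_not] at hcon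
    obtain ⟨⟨ζ, hζ⟩, h₁, h₂⟩ := hcon
    obtain ⟨β, 𝔟, -, -, hmem, hne⟩ := Capitulation.exists_kummer_class_mem_kappaMinus hp hp2 hdeg hζ
      (fun h ↦ h₁ ⟨⟨ζ, hζ⟩, h⟩) (fun h ↦ h₂ ⟨⟨ζ, hζ⟩, h⟩)
    rw [hbot, Subgroup.mem_bot] at hmem
    exact hne hmem
  · have hnt : ¬ Capitulation.kappaMinus k L = ⊥ := by
      intro h
      rw [h, Subgroup.card_bot] at hcard
      exact hp.one_lt.ne hcard
    have hcon := mt htriv hnt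
    rw [not_or, not_or, not_not] at hcon
    obtain ⟨⟨ζ, hζ⟩, h₁, h₂⟩ := hcon
    obtain ⟨β, 𝔟, hgen, hβ, hmem, hne⟩ := Capitulation.exists_kummer_class_mem_kappaMinus hp hp2
      hdeg hζ (fun h ↦ h₁ ⟨⟨ζ, hζ⟩, h⟩) (fun h ↦ h₂ ⟨⟨ζ, hζ⟩, h⟩)
    refine ⟨β, 𝔟, hgen, hβ, ?_⟩
    have hle : Subgroup.zpowers (ClassGroup.mk0 𝔟) ≤ Capitulation.kappaMinus k L :=
      Subgroup.zpowers_le.2 hmem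
    have hdvd := Subgroup.card_dvd_of_le hle
    -- A nontrivial element of a group of prime order generates it.
    rw [hcard, Nat.dvd_prime hp, Nat.card_zpowers, orderOf_eq_one_iff] at hdvd
    refine (Subgroup.eq_of_le_of_card_ge hle ?_).symm
    rw [hcard, Nat.card_zpowers, hdvd.resolve_left hne]
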